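/- Let $V$ be a finite-dimensional real vector space with a non-degenerate quadratic form $Q$. For a real vector space $U$ with quadratic form $q$, let $\mathrm{Cl}(U)$ be its universal Clifford algebra with the sign convention $u^2=-q(u)$ for $u\in U$; real numbers and vectors are regarded as elements of $\mathrm{Cl}(U)$ via $\mathbb{R}\cdot 1\subset\mathrm{Cl}(U)$ and $U\subset\mathrm{Cl}(U)$. Let $a\mapsto\hat a$ be the grade involution (the algebra automorphism with $u\mapsto -u$ on $U$), $a\mapsto\tilde a$ the reversal (the linear anti-automorphism with $u\mapsto u$ on $U$), and $\bar a=\hat{\tilde a}$ the Clifford conjugation. The Lipschitz group is $$\Gamma(U)=\{a\in\mathrm{Cl}(U)\ :\ a\text{ is invertible and } a\,x\,\hat a^{-1}\in U\text{ for all }x\in U\}.$$ Let $V\oplus\mathbb{R}^{1,1}$, where $\mathbb{R}^{1,1}$ has basis $e_-,e_+$, carry the quadratic form $\hat Q(v+x_-e_-+x_+e_+)=Q(v)-x_-^2+x_+^2$. Identify $\mathrm{Cl}(V\oplus\mathbb{R}^{1,1})$ with the algebra $\mathrm{Mat}(2,\mathrm{Cl}(V))$ of $2\times2$ matrices over $\mathrm{Cl}(V)$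 through the algebra isomorphism that extends $$v+x_-e_-+x_+e_+\ \longmapsto\ \begin{pmatrix} v & x_--x_+\\ x_-+x_+ & -v\end{pmatrix}.$$ Let $A=\begin{pmatrix} a&b\\ c&d\end{pmatrix}\in\mathrm{Mat}(2,\mathrm{Cl}(V))$. Then $A\in\Gamma(V\oplus\mathbb{R}^{1,1})$ if and only if all of the following hold: 1. $a\bar a,\ b\bar b,\ c\bar c,\ d\bar d\in\mathbb{R}$; 2. $a\bar c,\ b\bar d\in V$; 3. $a v\bar b-b v\bar a\in\mathbb{R}$ and $c v\bar d-d v\bar c\in\mathbb{R}$ for all $v\in V$; 4. $a v\bar d-b v\bar c\in V$ for all $v\in V$; 5. $a\tilde b=b\tilde a$ and $c\tilde d=d\tilde c$; 6. the pseudo-determinant $\Delta(A)=a\tilde d-b\tilde c$ is a nonzero real number. -/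

import Mathlib

noncomputable section

namespace Vahlen

variable {V : Type*} [AddCommGroup V] [Module ℝ V]

/-- The Clifford algebra `Cl(V)` of `(V, Q)` with the sign convention `v * v = -Q v`. -/
abbrev Cl (Q : QuadraticForm ℝ V) : Type _ := CliffordAlgebra (-Q)

/-- The inclusion of `V` into `Cl(V)`. -/
abbrev vec (Q : QuadraticForm ℝ V) : V →ₗ[ℝ] Cl Q := CliffordAlgebra.ι (-Q)

/-- The grade involution: the algebra automorphism with `v ↦ -v` on `V`. -/
abbrev gradeInv {Q : QuadraticForm ℝ V} (a : Cl Q) : Cl Q := CliffordAlgebra.involute a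

/-- The reversal: the linear anti-automorphism that is the identity on `V`. -/
abbrev rev {Q : QuadraticForm ℝ V} (a : Cl Q) : Cl Q := CliffordAlgebra.reverse a

/-- The Clifford conjugation: the grade involution of the reversal. -/
def conj {Q : QuadraticForm ℝ V} (a : Cl Q) : Cl Q := gradeInv (rev a)

/-- `a` is a real number, i.e. a scalar multiple of the identity of `Cl(V)`. -/
def IsReal {Q : QuadraticForm ℝ V} (a : Cl Q) : Prop := ∃ r : ℝ, a = algebraMap ℝ (Cl Q) r

/-- `a` lies in the subspace `V` of `Cl(V)`. -/
def IsVec {Q : QuadraticForm ℝ V} (a : Cl Q) : Prop := ∃ v : V, a = vec Q v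

/-- The Lipschitz group `Γ(V)`, as a subset of `Cl(V)`: the invertible `a` such that
the twisted adjoint action `x ↦ a x â⁻¹` preserves `V`. -/
def lipschitzGroup (Q : QuadraticForm ℝ V) : Set (Cl Q) :=
  {a | ∃ h : IsUnit a, ∀ x : V, IsVec (a * vec Q x * gradeInv (↑(h.unit⁻¹) : Cl Q))}

/-- The quadratic form on `V ⊕ ℝ^{1,1}`; the triple `(v, s, t)` stands for `v + s e₋ + t e₊`,
and its value is `Q v - s ^ 2 + t ^ 2`. -/
def hatQ (Q : QuadraticForm ℝ V) : QuadraticForm ℝ (V × ℝ × ℝ) :=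
  Q.prod ((-QuadraticMap.sq).prod QuadraticMap.sq)

theorem hatQ_apply (Q : QuadraticForm ℝ V) (v : V) (s t : ℝ) :
    hatQ Q (v, s, t) = Q v - s ^ 2 + t ^ 2 := by
  simp [hatQ]; ring

/-- The Clifford map `v + s e₋ + t e₊ ↦ (v, s - t; s + t, -v)`. -/
def cliffordMap (Q : QuadraticForm ℝ V) :
    (V × ℝ × ℝ) →ₗ[ℝ] Matrix (Fin 2) (Fin 2) (Cl Q) where
  toFun x := !![vec Q x.1, algebraMap ℝ _ (x.2.1 - x.2.2);
    algebraMap ℝ _ (x.2.1 + x.2.2), -vec Q x.1]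
  map_add' x y := by
    ext i j
    fin_cases i <;> fin_cases j <;> simp <;> abel
  map_smul' r x := by
    ext i j
    fin_cases i <;> fin_cases j <;> simp [Algebra.smul_def, mul_sub, mul_add]

theorem vec_mul_self (Q : QuadraticForm ℝ V) (v : V) :
    vec Q v * vec Q v = -algebraMap ℝ (Cl Q) (Q v) := by
  simp [vec, CliffordAlgebra.ι_sq_scalar]

theorem cliffordMap_sq (Q : QuadraticForm ℝ V) (x : V × ℝ × ℝ) :
    cliffordMap Q x * cliffordMap Q x = algebraMap ℝ _ ((-hatQ Q) x) := by
  obtain ⟨v, s, t⟩ := x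
  have h : ∀ r : ℝ, vec Q v * algebraMap ℝ (Cl Q) r = algebraMap ℝ (Cl Q) r * vec Q v :=
    fun r => (Algebra.commutes r _).symm
  ext i j
  rw [neg_apply, hatQ_apply, Matrix.algebraMap_matrix_apply]
  fin_cases i <;> fin_cases j <;>
    simp [cliffordMap, Matrix.mul_apply, Fin.sum_univ_two, h, vec_mul_self, pow_two,
      -CliffordAlgebra.ι_sq_scalar, mul_add, mul_sub, add_mul, sub_mul,
      ← map_mul, mul_comm] <;> abel

/-- The algebra homomorphism `Cl(V ⊕ ℝ^{1,1}) → Mat(2, Cl(V))` induced by the Clifford map. -/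
def toMat (Q : QuadraticForm ℝ V) : Cl (hatQ Q) →ₐ[ℝ] Matrix (Fin 2) (Fin 2) (Cl Q) :=
  CliffordAlgebra.lift (-hatQ Q) ⟨cliffordMap Q, cliffordMap_sq Q⟩

theorem toMat_vec (Q : QuadraticForm ℝ V) (x : V × ℝ × ℝ) :
    toMat Q (vec (hatQ Q) x) = cliffordMap Q x := by
  simp [toMat, vec]

/-- The inclusion of `Cl(V)` into `Cl(V ⊕ ℝ^{1,1})`. -/
def incl (Q : QuadraticForm ℝ V) : Cl Q →ₐ[ℝ] Cl (hatQ Q) :=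
  CliffordAlgebra.lift (-Q) ⟨vec (hatQ Q) ∘ₗ LinearMap.inl ℝ V (ℝ × ℝ), fun v => by
    simp [vec_mul_self, Prod.mk_zero_zero.symm, hatQ_apply, -CliffordAlgebra.ι_sq_scalar]⟩

theorem incl_vec (Q : QuadraticForm ℝ V) (v : V) :
    incl Q (vec Q v) = vec (hatQ Q) (v, 0, 0) := by
  simp [incl, vec]; rfl

theorem toMat_incl (Q : QuadraticForm ℝ V) (a : Cl Q) :
    toMat Q (incl Q a) = !![a, 0; 0, gradeInv a] := by
  induction a using CliffordAlgebra.left_induction with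
  | algebraMap r =>
    ext i j
    fin_cases i <;> fin_cases j <;> simp [Matrix.algebraMap_matrix_apply]
  | add x y hx hy =>
    rw [map_add, map_add, hx, hy]
    ext i j
    fin_cases i <;> fin_cases j <;> simp
  | ι_mul x v hx =>
    rw [map_mul, map_mul, hx]
    erw [incl_vec, toMat_vec]
    ext i j
    fin_cases i <;> fin_cases j <;> simp [cliffordMap, Matrix.mul_apply, Fin.sum_univ_two]

/-- The vector `e₋`, with square `1`. -/
def eNeg (Q : QuadraticForm ℝ V) : Cl (hatQ Q) := vec (hatQ Q) (0, 1, 0)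

/-- The vector `e₊`, with square `-1`. -/
def ePos (Q : QuadraticForm ℝ V) : Cl (hatQ Q) := vec (hatQ Q) (0, 0, 1)

theorem vec_mul_vec (Q : QuadraticForm ℝ V) {x y : V × ℝ × ℝ}
    (h : hatQ Q (x + y) = hatQ Q x + hatQ Q y) :
    vec (hatQ Q) x * vec (hatQ Q) y = -(vec (hatQ Q) y * vec (hatQ Q) x) := by
  refine CliffordAlgebra.ι_mul_ι_comm_of_isOrtho ?_
  rw [QuadraticMap.isOrtho_def]
  simp only [neg_apply, h]
  ring

theorem eNeg_sq (Q : QuadraticForm ℝ V) : eNeg Q * eNeg Q = 1 := by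
  rw [eNeg, vec_mul_self, hatQ_apply]; simp

theorem ePos_sq (Q : QuadraticForm ℝ V) : ePos Q * ePos Q = -1 := by
  rw [ePos, vec_mul_self, hatQ_apply]; simp

theorem ePos_mul_eNeg (Q : QuadraticForm ℝ V) : ePos Q * eNeg Q = -(eNeg Q * ePos Q) := by
  apply vec_mul_vec; simp [hatQ_apply]

theorem mul_incl (Q : QuadraticForm ℝ V) (s t : ℝ) (a : Cl Q) :
    vec (hatQ Q) (0, s, t) * incl Q a = incl Q (gradeInv a) * vec (hatQ Q) (0, s, t) := by
  induction a using CliffordAlgebra.left_induction with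
  | algebraMap r => simp [Algebra.commutes]
  | add x y hx hy => simp only [map_add, mul_add, add_mul, hx, hy, gradeInv] at *
  | ι_mul x v hx =>
    have h := vec_mul_vec Q (x := (0, s, t)) (y := (v, 0, 0)) (by simp [hatQ_apply]; ring)
    have e := incl_vec Q v
    simp only [gradeInv, map_mul, CliffordAlgebra.involute_ι, map_neg] at *
    erw [e]
    rw [← mul_assoc, h, neg_mul, mul_assoc, hx]
    simp only [neg_mul, mul_assoc]

/-- The inverse of `toMat`. -/
def ofMat (Q : QuadraticForm ℝ V) (M : Matrix (Fin 2) (Fin 2) (Cl Q)) : Cl (hatQ Q) :=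
  (2⁻¹ : ℝ) • (incl Q (M 0 0 + gradeInv (M 1 1)) + incl Q (M 0 1 + gradeInv (M 1 0)) * eNeg Q
    + incl Q (gradeInv (M 1 0) - M 0 1) * ePos Q
    + incl Q (M 0 0 - gradeInv (M 1 1)) * (eNeg Q * ePos Q))

theorem toMat_ofMat (Q : QuadraticForm ℝ V) (M : Matrix (Fin 2) (Fin 2) (Cl Q)) :
    toMat Q (ofMat Q M) = M := by
  rw [ofMat, map_smul]
  simp only [map_add, map_mul, map_sub, toMat_incl, eNeg, ePos, toMat_vec]
  rw [inv_smul_eq_iff₀ two_ne_zero]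
  ext i j
  fin_cases i <;> fin_cases j <;>
    simp [cliffordMap, two_smul] <;> abel

theorem ofMat_mul (Q : QuadraticForm ℝ V) (x : V × ℝ × ℝ) (M : Matrix (Fin 2) (Fin 2) (Cl Q)) :
    ofMat Q (cliffordMap Q x * M) = vec (hatQ Q) x * ofMat Q M := by
  obtain ⟨v, s, t⟩ := x
  have hx : vec (hatQ Q) (v, s, t) = incl Q (vec Q v) + s • eNeg Q + t • ePos Q := by
    rw [incl_vec, eNeg, ePos, ← map_smul, ← map_smul, ← map_add, ← map_add]
    simp
  have hE : ∀ a, eNeg Q * incl Q a = incl Q (gradeInv a) * eNeg Q := mul_incl Q 1 0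
  have hF : ∀ a, ePos Q * incl Q a = incl Q (gradeInv a) * ePos Q := mul_incl Q 0 1
  have hE' : ∀ a y, eNeg Q * (incl Q a * y) = incl Q (gradeInv a) * (eNeg Q * y) :=
    fun a y => by rw [← mul_assoc, hE, mul_assoc]
  have hF' : ∀ a y, ePos Q * (incl Q a * y) = incl Q (gradeInv a) * (ePos Q * y) :=
    fun a y => by rw [← mul_assoc, hF, mul_assoc]
  have hEE : ∀ y, eNeg Q * (eNeg Q * y) = y := fun y => by
    rw [← mul_assoc, eNeg_sq, one_mul]
  have hFE : ∀ y, ePos Q * (eNeg Q * y) = -(eNeg Q * (ePos Q * y)) := fun y => by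
    rw [← mul_assoc, ePos_mul_eNeg, neg_mul, mul_assoc]
  have hg : gradeInv (vec Q v) = -vec Q v := CliffordAlgebra.involute_ι v
  have hgg : ∀ a : Cl Q, gradeInv (gradeInv a) = a := CliffordAlgebra.involute_involute
  simp only [gradeInv] at hE hF hE' hF' hg hgg
  rw [hx, ofMat, ofMat, mul_smul_comm]
  congr 1
  simp only [cliffordMap, LinearMap.coe_mk, AddHom.coe_mk, Matrix.mul_apply, Fin.sum_univ_two,
    Matrix.of_apply, Matrix.cons_val_zero, Matrix.cons_val_one, Matrix.cons_val', gradeInv,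
    Matrix.cons_val_fin_one, ← Algebra.smul_def, map_add, map_sub, map_mul, map_smul, map_neg,
    mul_add, mul_sub, add_mul, sub_mul, mul_assoc, smul_mul_assoc, neg_mul, mul_neg,
    hE, hF, hE', hF', hEE, hFE, eNeg_sq, ePos_sq, ePos_mul_eNeg, hg, hgg, mul_one, smul_neg, neg_neg]
  module

theorem ofMat_toMat (Q : QuadraticForm ℝ V) (x : Cl (hatQ Q)) : ofMat Q (toMat Q x) = x := by
  induction x using CliffordAlgebra.left_induction with
  | algebraMap r =>
    simp [ofMat, Matrix.algebraMap_matrix_apply, ← two_smul ℝ, smul_smul]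
  | add x y hx hy =>
    rw [← add_comm y x]
    nth_rewrite 2 [← hx, ← hy]
    simp only [ofMat, map_add, Matrix.add_apply, gradeInv, ← smul_add]
    congr 1
    simp only [map_add, map_sub, add_mul, sub_mul]
    abel
  | ι_mul x m hx =>
    rw [map_mul]
    erw [toMat_vec, ofMat_mul, hx]

/-- The isomorphism `Cl(V ⊕ ℝ^{1,1}) ≃ Mat(2, Cl(V))` extending the Clifford map. -/
def matEquiv (Q : QuadraticForm ℝ V) : Cl (hatQ Q) ≃ₐ[ℝ] Matrix (Fin 2) (Fin 2) (Cl Q) :=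
  AlgEquiv.ofBijective (toMat Q)
    ⟨Function.LeftInverse.injective (ofMat_toMat Q),
      Function.RightInverse.surjective (toMat_ofMat Q)⟩

/-- The Vahlen matrices: the matrices in the Lipschitz group `Γ(V ⊕ ℝ^{1,1})` under the
identification `matEquiv`. -/
def IsVahlen (Q : QuadraticForm ℝ V) (A : Matrix (Fin 2) (Fin 2) (Cl Q)) : Prop :=
  (matEquiv Q).symm A ∈ lipschitzGroup (hatQ Q)

/-- The pseudo-determinant of a matrix. -/
def pseudoDet {Q : QuadraticForm ℝ V} (A : Matrix (Fin 2) (Fin 2) (Cl Q)) : Cl Q :=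
  A 0 0 * rev (A 1 1) - A 0 1 * rev (A 1 0)

end Vahlen

end

/-! For a non-degenerate form, membership in the Lipschitz group means that the norm `a * conj a` is
a nonzero real and every `a * v * rev a` is a vector (`mem_lipschitzGroup_iff`). In the matrix model
the norm condition on `V ⊕ ℝ^{1,1}` becomes conditions 5 and 6, and the entries of the sandwiched
vector give conditions 1 to 4 (`toMat_conj`, `toMat_sandwich`). The substantial point is that the
norm is scalar. For `a` in the group, `conj a * a` satisfies `z * v = v * gradeInv z`. Twisted
commutators with vectors are contractions by the polar form, so non-degeneracy makes every
contraction of `gradeInv z` vanish. Carried to the exterior algebra, this leaves only degree 0, by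
the Euler operator. -/

namespace CliffordAlgebra

/-! ### Contractions and the twisted centre -/

variable {R M : Type*} [CommRing R] [AddCommGroup M] [Module R M] {q : QuadraticForm R M}

theorem ι_mul_sub_involute_mul_ι (v : M) (x : CliffordAlgebra q) :
    ι q v * x - involute x * ι q v = contractLeft (QuadraticMap.polarBilin q v) x := by
  induction x using CliffordAlgebra.left_induction with
  | algebraMap r =>
    rw [contractLeft_algebraMap, AlgHom.commutes, Algebra.commutes, sub_self]
  | add x y hx hy =>
    rw [map_add, map_add, ← hx, ← hy, mul_add, add_mul]
    abel
  | ι_mul x w hx =>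
    rw [contractLeft_ι_mul, ← hx, map_mul, involute_ι, QuadraticMap.polarBilin_apply_apply,
      Algebra.smul_def, ← ι_mul_ι_add_swap]
    noncomm_ring

/-- The Euler operator `x ↦ ∑ i, e i ∧ (e i)* ⌋ x` of the exterior algebra. -/
noncomputable def eulerOperator {n : Type*} [Fintype n] (e : Module.Basis n R M) :
    ExteriorAlgebra R M →ₗ[R] ExteriorAlgebra R M :=
  ∑ i, LinearMap.mulLeft R (ExteriorAlgebra.ι R (e i)) ∘ₗ
    contractLeft (Q := (0 : QuadraticForm R M)) (e.coord i)

theorem eulerOperator_apply {n : Type*} [Fintype n] (e : Module.Basis n R M)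
    (x : ExteriorAlgebra R M) :
    eulerOperator e x = ∑ i, ExteriorAlgebra.ι R (e i) *
      contractLeft (Q := (0 : QuadraticForm R M)) (e.coord i) x := by
  simp only [eulerOperator, LinearMap.sum_apply]
  rfl

/-- Contraction is an antiderivation: its scalar terms reassemble `v` from its coordinates, and its
sign cancels against that of moving `e i` past `v`. -/
theorem eulerOperator_ι_mul {n : Type*} [Fintype n] (e : Module.Basis n R M) (v : M)
    (x : ExteriorAlgebra R M) :
    eulerOperator e (ExteriorAlgebra.ι R v * x) =
      ExteriorAlgebra.ι R v * x + ExteriorAlgebra.ι R v * eulerOperator e x := by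
  have hv : ExteriorAlgebra.ι R v = ∑ i, e.repr v i • ExteriorAlgebra.ι R (e i) := by
    conv_lhs => rw [← e.sum_repr v]
    simp only [map_sum, map_smul]
  have hc : ∀ i, ExteriorAlgebra.ι R (e i) *
      contractLeft (Q := (0 : QuadraticForm R M)) (e.coord i) (ExteriorAlgebra.ι R v * x) =
      (e.repr v i • ExteriorAlgebra.ι R (e i)) * x + ExteriorAlgebra.ι R v *
        (ExteriorAlgebra.ι R (e i) *
          contractLeft (Q := (0 : QuadraticForm R M)) (e.coord i) x) := by
    intro i
    have h := contractLeft_ι_mul (Q := (0 : QuadraticForm R M)) (d := e.coord i) v x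
    have hs : ExteriorAlgebra.ι R (e i) * ExteriorAlgebra.ι R v =
        -(ExteriorAlgebra.ι R v * ExteriorAlgebra.ι R (e i)) :=
      eq_neg_of_add_eq_zero_left (ExteriorAlgebra.ι_add_mul_swap _ _)
    erw [h]
    rw [mul_sub, mul_smul_comm, smul_mul_assoc, sub_eq_add_neg, ← mul_assoc, ← mul_assoc]
    erw [hs]
    rw [neg_mul, neg_neg]
    rfl
  rw [eulerOperator_apply, eulerOperator_apply, Finset.sum_congr rfl fun i _ => hc i,
    Finset.sum_add_distrib, ← Finset.sum_mul, ← hv, ← Finset.mul_sum]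

theorem eulerOperator_of_mem {n : Type*} [Fintype n] (e : Module.Basis n R M) {k : ℕ}
    {x : ExteriorAlgebra R M} (hx : x ∈ ⋀[R]^k M) : eulerOperator e x = k • x := by
  induction hx using Submodule.pow_induction_on_left' with
  | algebraMap r =>
    rw [eulerOperator_apply, zero_smul]
    refine Finset.sum_eq_zero fun i _ => ?_
    erw [contractLeft_algebraMap (Q := (0 : QuadraticForm R M))]
    rw [mul_zero]
  | add x y j _ _ hx hy => rw [map_add, hx, hy, smul_add]
  | mem_mul m hm j x _ hx =>
    obtain ⟨v, rfl⟩ := hm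
    rw [eulerOperator_ι_mul, hx, mul_smul_comm, succ_nsmul']

theorem decompose_eulerOperator {n : Type*} [Fintype n] (e : Module.Basis n R M)
    (x : ExteriorAlgebra R M) (k : ℕ) :
    (DirectSum.decompose (fun i : ℕ => ⋀[R]^i M) (eulerOperator e x) k : ExteriorAlgebra R M) =
      k • (DirectSum.decompose (fun i : ℕ => ⋀[R]^i M) x k : ExteriorAlgebra R M) := by
  induction x using DirectSum.Decomposition.inductionOn fun i : ℕ => ⋀[R]^i M with
  | zero => simp
  | add x y hx hy =>
    simp only [map_add, DirectSum.decompose_add, DirectSum.add_apply, Submodule.coe_add, hx, hy,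
      smul_add]
  | @homogeneous j m =>
    rw [eulerOperator_of_mem e m.2]
    by_cases h : j = k
    · subst h
      rw [DirectSum.decompose_of_mem_same (fun i : ℕ => ⋀[R]^i M) (Submodule.smul_of_tower_mem _ j m.2),
        DirectSum.decompose_of_mem_same (fun i : ℕ => ⋀[R]^i M) m.2]
    · rw [DirectSum.decompose_of_mem_ne (fun i : ℕ => ⋀[R]^i M) (Submodule.smul_of_tower_mem _ j m.2) h,
        DirectSum.decompose_of_mem_ne (fun i : ℕ => ⋀[R]^i M) m.2 h, smul_zero]

/-- The Euler operator kills `x` but multiplies its degree `k` part by `k`, which is invertible for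
`k ≠ 0` in characteristic zero. -/
theorem _root_.ExteriorAlgebra.exists_algebraMap_of_contractLeft_eq_zero {K W : Type*} [Field K]
    [CharZero K] [AddCommGroup W] [Module K W] [FiniteDimensional K W] {x : ExteriorAlgebra K W}
    (hx : ∀ d : Module.Dual K W, contractLeft (Q := (0 : QuadraticForm K W)) d x = 0) :
    ∃ r : K, x = algebraMap K _ r := by
  have hE : eulerOperator (Module.finBasis K W) x = 0 := by
    rw [eulerOperator_apply]
    exact Finset.sum_eq_zero fun i _ => by rw [hx, mul_zero]
  have hk : ∀ k : ℕ, k ≠ 0 →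
      (DirectSum.decompose (fun i : ℕ => ⋀[K]^i W) x k : ExteriorAlgebra K W) = 0 := by
    intro k hk
    have h := decompose_eulerOperator (Module.finBasis K W) x k
    rw [hE, DirectSum.decompose_zero, DirectSum.zero_apply, ZeroMemClass.coe_zero,
      ← Nat.cast_smul_eq_nsmul K] at h
    exact (smul_eq_zero.mp h.symm).resolve_left (Nat.cast_ne_zero.mpr hk)
  have hx0 : x ∈ ⋀[K]^0 W := by
    classical
    rw [← DirectSum.sum_support_decompose (fun i : ℕ => ⋀[K]^i W) x]
    refine Submodule.sum_mem _ fun k _ => ?_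
    by_cases h : k = 0
    · subst h
      exact Subtype.property _
    · rw [hk k h]
      exact Submodule.zero_mem _
  rw [ExteriorAlgebra.exteriorPower, pow_zero, Submodule.mem_one] at hx0
  exact hx0.imp fun r hr => hr.symm

/-- The linear isomorphism `equivExterior` is a change of form, hence commutes with contractions and
fixes scalars. -/
theorem exists_algebraMap_of_contractLeft_eq_zero {K W : Type*} [Field K]
    [CharZero K] [AddCommGroup W] [Module K W] [FiniteDimensional K W] {q : QuadraticForm K W}
    {x : CliffordAlgebra q} (hx : ∀ d : Module.Dual K W, contractLeft d x = 0) :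
    ∃ r : K, x = algebraMap K _ r := by
  have : Invertible (2 : K) := invertibleOfNonzero two_ne_zero
  obtain ⟨r, hr⟩ := ExteriorAlgebra.exists_algebraMap_of_contractLeft_eq_zero
    (x := equivExterior q x) fun d => by
      have h := changeForm_contractLeft (changeForm.associated_neg_proof (Q := q)) d x
      rw [hx, map_zero] at h
      exact h.symm
  refine ⟨r, (equivExterior q).injective (hr.trans ?_)⟩
  exact (changeForm_algebraMap (changeForm.associated_neg_proof (Q := q)) r).symm

/-- The twisted centre of the Clifford algebra of a non-degenerate form consists of scalars. -/
theorem exists_algebraMap_of_forall_mul_ι_eq {K W : Type*} [Field K]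
    [CharZero K] [AddCommGroup W] [Module K W] [FiniteDimensional K W] {q : QuadraticForm K W}
    (hq : (QuadraticMap.associated q).Nondegenerate) {x : CliffordAlgebra q}
    (hx : ∀ v, x * ι q v = ι q v * involute x) : ∃ r : K, x = algebraMap K _ r := by
  obtain ⟨r, hr⟩ : ∃ r : K, involute x = algebraMap K (CliffordAlgebra q) r := by
    refine exists_algebraMap_of_contractLeft_eq_zero fun d => ?_
    -- The polar form is twice the associated form, so the vector representing `d` is halved.
    have hd : QuadraticMap.polarBilin q
        ((2⁻¹ : K) • (LinearMap.BilinForm.toDual _ hq).symm d) = d := by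
      rw [← QuadraticMap.two_nsmul_associated K q]
      ext w
      have h := LinearMap.BilinForm.apply_toDual_symm_apply (hB := hq) d w
      simp only [map_smul, LinearMap.smul_apply, h]
      rw [nsmul_eq_mul, smul_eq_mul, Nat.cast_ofNat, inv_mul_cancel_left₀ two_ne_zero]
    rw [← hd, ← ι_mul_sub_involute_mul_ι, involute_involute, hx, sub_self]
  exact ⟨r, by rw [← involute_involute x, hr, AlgHom.commutes]⟩

instance instFiniteDimensional {K W : Type*} [Field K]
    [CharZero K] [AddCommGroup W] [Module K W] [FiniteDimensional K W] (q : QuadraticForm K W) :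
    FiniteDimensional K (CliffordAlgebra q) := by
  have : Invertible (2 : K) := invertibleOfNonzero two_ne_zero
  have : Module.Finite K (ExteriorAlgebra K W) :=
    Module.Finite.of_basis (Module.finBasis K W).ExteriorAlgebra
  exact Module.Finite.equiv (equivExterior q).symm

end CliffordAlgebra

namespace Vahlen

open CliffordAlgebra

/-! ### Clifford conjugation, vectors and scalars -/

section Conj

variable {V : Type*} [AddCommGroup V] [Module ℝ V] {Q : QuadraticForm ℝ V}

theorem conj_mul (a b : Cl Q) : conj (a * b) = conj b * conj a := by
  simp [conj, reverse.map_mul]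

theorem conj_add (a b : Cl Q) : conj (a + b) = conj a + conj b := by
  simp [conj]

theorem conj_neg (a : Cl Q) : conj (-a) = -conj a := by
  simp [conj]

theorem conj_sub (a b : Cl Q) : conj (a - b) = conj a - conj b := by
  simp [conj]

theorem conj_conj (a : Cl Q) : conj (conj a) = a := by
  simp [conj, reverse_involute]

theorem conj_algebraMap (r : ℝ) : conj (algebraMap ℝ (Cl Q) r) = algebraMap ℝ (Cl Q) r := by
  simp [conj]

theorem conj_vec (v : V) : conj (vec Q v) = -vec Q v := by
  simp [conj]

theorem gradeInv_conj (a : Cl Q) : gradeInv (conj a) = rev a := by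
  simp [conj]

theorem rev_gradeInv (a : Cl Q) : rev (gradeInv a) = conj a :=
  reverse_involute a

theorem IsVec.smul {a : Cl Q} (h : IsVec a) (r : ℝ) : IsVec (r • a) := by
  obtain ⟨v, rfl⟩ := h
  exact ⟨r • v, (map_smul _ r v).symm⟩

theorem IsVec.add {a b : Cl Q} (ha : IsVec a) (hb : IsVec b) : IsVec (a + b) := by
  obtain ⟨v, rfl⟩ := ha
  obtain ⟨w, rfl⟩ := hb
  exact ⟨v + w, (map_add _ v w).symm⟩

theorem IsReal.smul {a : Cl Q} (h : IsReal a) (r : ℝ) : IsReal (r • a) := by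
  obtain ⟨s, rfl⟩ := h
  exact ⟨r * s, by rw [map_mul, Algebra.smul_def]⟩

theorem IsReal.add {a b : Cl Q} (ha : IsReal a) (hb : IsReal b) : IsReal (a + b) := by
  obtain ⟨r, rfl⟩ := ha
  obtain ⟨s, rfl⟩ := hb
  exact ⟨r + s, (map_add _ r s).symm⟩

end Conj

/-! ### The Lipschitz group through norm and sandwich -/

section Lipschitz

variable {V : Type*} [AddCommGroup V] [Module ℝ V] [FiniteDimensional ℝ V] {Q : QuadraticForm ℝ V}

/-- One-sided inverses are two-sided in a finite-dimensional, hence Artinian, algebra. -/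
theorem mul_conj_comm_of_eq_algebraMap {a : Cl Q} {r : ℝ} (hr : r ≠ 0)
    (h : a * conj a = algebraMap ℝ (Cl Q) r) : conj a * a = algebraMap ℝ (Cl Q) r := by
  have : IsArtinianRing (Cl Q) := IsArtinianRing.of_finite ℝ _
  have h1 : a * (r⁻¹ • conj a) = 1 := by
    rw [mul_smul_comm, h, Algebra.algebraMap_eq_smul_one, smul_smul, inv_mul_cancel₀ hr, one_smul]
  have h2 := mul_eq_one_symm h1
  rw [smul_mul_assoc, inv_smul_eq_iff₀ hr] at h2
  rw [h2, Algebra.algebraMap_eq_smul_one]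

/-- For an element of the Lipschitz group, the spinor norm is a non-zero scalar. -/
theorem exists_conj_mul_self_of_mem_lipschitzGroup
    (hQ : (QuadraticMap.associated (-Q)).Nondegenerate) {a : Cl Q} (ha : a ∈ lipschitzGroup Q) :
    ∃ r : ℝ, r ≠ 0 ∧ conj a * a = algebraMap ℝ (Cl Q) r := by
  obtain ⟨hu, ha⟩ := ha
  have hinv : gradeInv (↑(hu.unit⁻¹) : Cl Q) * gradeInv a = 1 := by
    rw [gradeInv, gradeInv, ← map_mul, hu.val_inv_mul, map_one]
  -- With `a * x = y * gradeInv a`, reversal gives `x * rev a = conj a * y`; together they move `x`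
  -- through `conj a * a`.
  obtain ⟨r, hr⟩ := exists_algebraMap_of_forall_mul_ι_eq hQ (x := conj a * a) fun x => by
    obtain ⟨y, hy⟩ := ha x
    have h1 : a * vec Q x = vec Q y * gradeInv a := by
      rw [← hy, mul_assoc, hinv, mul_one]
    have h2 : vec Q x * rev a = conj a * vec Q y := by
      have h := congrArg rev h1
      rwa [rev, reverse.map_mul, rev, reverse.map_mul, reverse_ι, reverse_ι,
        ← rev, ← rev, rev_gradeInv] at h
    rw [map_mul]
    change conj a * a * vec Q x = vec Q x * (gradeInv (conj a) * gradeInv a)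
    rw [gradeInv_conj, mul_assoc, h1, ← mul_assoc, ← h2, mul_assoc]
  refine ⟨r, ?_, hr⟩
  rintro rfl
  have : Nontrivial (Cl Q) := inferInstance
  rw [map_zero] at hr
  have h0 := (hu.mul_left_eq_zero).mp hr
  have ha0 : a = 0 := by rw [← conj_conj a, h0]; simp [conj]
  exact hu.ne_zero ha0

/-- A scalar norm makes `rev a` a nonzero real multiple of `gradeInv a⁻¹`, so the two sandwiches
differ by a scalar. -/
theorem mem_lipschitzGroup_iff (hQ : (QuadraticMap.associated (-Q)).Nondegenerate) (a : Cl Q) :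
    a ∈ lipschitzGroup Q ↔ (∃ r : ℝ, r ≠ 0 ∧ a * conj a = algebraMap ℝ (Cl Q) r) ∧
      ∀ x, IsVec (a * vec Q x * rev a) := by
  have key : ∀ r : ℝ, conj a * a = algebraMap ℝ (Cl Q) r → ∀ hu : IsUnit a,
      rev a = r • gradeInv (↑(hu.unit⁻¹) : Cl Q) := by
    intro r hr hu
    have h := congrArg gradeInv hr
    rw [gradeInv, map_mul, gradeInv, AlgHom.commutes, ← gradeInv, ← gradeInv, gradeInv_conj] at h
    have hinv : gradeInv a * gradeInv (↑(hu.unit⁻¹) : Cl Q) = 1 := by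
      rw [gradeInv, gradeInv, ← map_mul, hu.mul_val_inv, map_one]
    rw [← mul_one (rev a), ← hinv, ← mul_assoc, h, Algebra.smul_def]
  constructor
  · intro ha
    obtain ⟨r, hr0, hr⟩ := exists_conj_mul_self_of_mem_lipschitzGroup hQ ha
    obtain ⟨hu, ha⟩ := ha
    refine ⟨⟨r, hr0, ?_⟩, fun x => ?_⟩
    · have h := mul_conj_comm_of_eq_algebraMap (a := conj a) hr0 (by rw [conj_conj, hr])
      rwa [conj_conj] at h
    · rw [key r hr hu, mul_smul_comm]
      exact (ha x).smul r
  · rintro ⟨⟨r, hr0, hr⟩, ha⟩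
    have hr' := mul_conj_comm_of_eq_algebraMap hr0 hr
    have hu : IsUnit a := by
      refine ⟨⟨a, r⁻¹ • conj a, ?_, ?_⟩, rfl⟩
      · rw [mul_smul_comm, hr, Algebra.algebraMap_eq_smul_one, inv_smul_smul₀ hr0]
      · rw [smul_mul_assoc, hr', Algebra.algebraMap_eq_smul_one, inv_smul_smul₀ hr0]
    refine ⟨hu, fun x => ?_⟩
    have h := (ha x).smul r⁻¹
    rwa [key r hr' hu, mul_smul_comm, inv_smul_smul₀ hr0] at h

end Lipschitz

/-! ### Involutions and sandwiches in the matrix model -/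

section Matrix

variable {V : Type*} [AddCommGroup V] [Module ℝ V] {Q : QuadraticForm ℝ V}

theorem nondegenerate_associated_neg_hatQ (hQ : (QuadraticMap.associated Q).Nondegenerate) :
    (QuadraticMap.associated (-hatQ Q)).Nondegenerate := by
  have h2 : ∀ {W : Type _} [AddCommGroup W] [Module ℝ W] (q : QuadraticForm ℝ W) (x y : W),
      2 * QuadraticMap.associated q x y = q (x + y) - q x - q y := by
    intro W _ _ q x y
    have h : (2 • QuadraticMap.associated q) x y = QuadraticMap.polarBilin q x y := by
      rw [QuadraticMap.two_nsmul_associated]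
    rw [two_nsmul] at h
    rw [two_mul]
    exact h
  have hB : ∀ x y : V × ℝ × ℝ, QuadraticMap.associated (-hatQ Q) x y =
      -QuadraticMap.associated Q x.1 y.1 + x.2.1 * y.2.1 - x.2.2 * y.2.2 := by
    rintro ⟨v, s, t⟩ ⟨w, s', t'⟩
    have h1 := h2 (-hatQ Q) (v, s, t) (w, s', t')
    have h3 := h2 Q v w
    simp only [neg_apply, Prod.mk_add_mk, hatQ_apply] at h1
    linear_combination (h1 + h3) / 2
  have hl : LinearMap.SeparatingLeft (QuadraticMap.associated (-hatQ Q)) := by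
    rintro ⟨v, s, t⟩ h
    have hv : v = 0 := hQ.1 v fun w => by simpa using (hB _ _).symm.trans (h (w, 0, 0))
    have hs : s = 0 := by simpa using (hB _ _).symm.trans (h (0, 1, 0))
    have ht : t = 0 := by simpa using (hB _ _).symm.trans (h (0, 0, 1))
    rw [hv, hs, ht]
    rfl
  refine ⟨hl, fun y h => hl y fun x => ?_⟩
  rw [← h x]
  exact QuadraticMap.associated_isSymm ℝ (-hatQ Q) y x

theorem toMat_gradeInv (x : Cl (hatQ Q)) :
    toMat Q (gradeInv x) = !![gradeInv (toMat Q x 0 0), -gradeInv (toMat Q x 0 1);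
      -gradeInv (toMat Q x 1 0), gradeInv (toMat Q x 1 1)] := by
  induction x using CliffordAlgebra.left_induction with
  | algebraMap r =>
    ext i j
    fin_cases i <;> fin_cases j <;> simp [Matrix.algebraMap_matrix_apply]
  | add x y hx hy =>
    rw [gradeInv, map_add, map_add, hx, hy]
    ext i j
    fin_cases i <;> fin_cases j <;> simp <;> abel
  | ι_mul x v hx =>
    rw [gradeInv, map_mul, map_mul, hx, involute_ι, map_neg, map_mul]
    erw [toMat_vec]
    ext i j
    fin_cases i <;> fin_cases j <;>
      simp [cliffordMap, Matrix.mul_apply, Fin.sum_univ_two, gradeInv, add_mul, sub_mul] <;> abel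

/-- The matrix operation on the right is the anti-automorphism fixing every `cliffordMap` matrix. -/
theorem toMat_rev (x : Cl (hatQ Q)) :
    toMat Q (rev x) = !![conj (toMat Q x 1 1), conj (toMat Q x 0 1);
      conj (toMat Q x 1 0), conj (toMat Q x 0 0)] := by
  induction x using CliffordAlgebra.left_induction with
  | algebraMap r =>
    ext i j
    fin_cases i <;> fin_cases j <;> simp [Matrix.algebraMap_matrix_apply, conj]
  | add x y hx hy =>
    rw [rev, map_add, map_add, hx, hy]
    ext i j
    fin_cases i <;> fin_cases j <;> simp [conj]
  | ι_mul x v hx =>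
    rw [rev, reverse.map_mul, map_mul, hx, reverse_ι, map_mul]
    erw [toMat_vec]
    ext i j
    fin_cases i <;> fin_cases j <;>
      simp [cliffordMap, Matrix.mul_apply, Fin.sum_univ_two, conj_add, conj_mul, conj_neg,
        conj_vec, conj_algebraMap, -map_add, -map_sub] <;> abel

theorem toMat_conj (x : Cl (hatQ Q)) :
    toMat Q (conj x) = !![rev (toMat Q x 1 1), -rev (toMat Q x 0 1);
      -rev (toMat Q x 1 0), rev (toMat Q x 0 0)] := by
  rw [conj, toMat_gradeInv, toMat_rev]
  simp [gradeInv_conj]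

theorem isVec_iff_toMat (x : Cl (hatQ Q)) :
    IsVec x ↔ IsVec (toMat Q x 0 0) ∧ IsReal (toMat Q x 0 1) ∧ IsReal (toMat Q x 1 0) ∧
      toMat Q x 1 1 = -toMat Q x 0 0 := by
  constructor
  · rintro ⟨⟨v, s, t⟩, rfl⟩
    rw [toMat_vec]
    exact ⟨⟨v, rfl⟩, ⟨s - t, rfl⟩, ⟨s + t, rfl⟩, rfl⟩
  · rintro ⟨⟨v, hv⟩, ⟨r, hr⟩, ⟨s, hs⟩, h⟩
    -- Solves `x₋ - x₊ = r` and `x₋ + x₊ = s`.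
    refine ⟨(v, 2⁻¹ * (r + s), 2⁻¹ * (s - r)), (Function.LeftInverse.injective (ofMat_toMat Q)) ?_⟩
    rw [toMat_vec]
    ext i j
    fin_cases i <;> fin_cases j
    · exact hv
    · refine hr.trans (congrArg _ ?_)
      ring
    · refine hs.trans (congrArg _ ?_)
      ring
    · exact h.trans (congrArg _ hv)

theorem toMat_sandwich (A : Matrix (Fin 2) (Fin 2) (Cl Q)) {x : Cl (hatQ Q)} (hx : toMat Q x = A)
    (v : V) (s t : ℝ) :
    toMat Q (x * vec (hatQ Q) (v, s, t) * rev x) =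
      !![A 0 0 * vec Q v * conj (A 1 1) - A 0 1 * vec Q v * conj (A 1 0)
          + (s + t) • (A 0 1 * conj (A 1 1)) + (s - t) • (A 0 0 * conj (A 1 0)),
        A 0 0 * vec Q v * conj (A 0 1) - A 0 1 * vec Q v * conj (A 0 0)
          + (s + t) • (A 0 1 * conj (A 0 1)) + (s - t) • (A 0 0 * conj (A 0 0));
        A 1 0 * vec Q v * conj (A 1 1) - A 1 1 * vec Q v * conj (A 1 0)
          + (s + t) • (A 1 1 * conj (A 1 1)) + (s - t) • (A 1 0 * conj (A 1 0)),
        A 1 0 * vec Q v * conj (A 0 1) - A 1 1 * vec Q v * conj (A 0 0)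
          + (s + t) • (A 1 1 * conj (A 0 1)) + (s - t) • (A 1 0 * conj (A 0 0))] := by
  have hc : ∀ (r : ℝ) (a : Cl Q), a * algebraMap ℝ (Cl Q) r = r • a := fun r a => by
    rw [← Algebra.commutes, Algebra.smul_def]
  rw [map_mul, map_mul, toMat_rev, toMat_vec, hx]
  ext i j
  fin_cases i <;> fin_cases j <;>
    simp [cliffordMap, Matrix.mul_apply, Fin.sum_univ_two, add_mul, hc, -map_add, -map_sub] <;>
    abel

end Matrix

end Vahlen

/-! ### The criterion for Vahlen matrices -/

open Vahlen in
theorem mainTheorem4 {V : Type*} [AddCommGroup V] [Module ℝ V] [FiniteDimensional ℝ V]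
    (Q : QuadraticForm ℝ V) (hQ : (QuadraticMap.associated Q).Nondegenerate) (a b c d : Cl Q) :
    IsVahlen Q !![a, b; c, d] ↔
      (IsReal (a * conj a) ∧ IsReal (b * conj b) ∧ IsReal (c * conj c) ∧ IsReal (d * conj d)) ∧
      (IsVec (a * conj c) ∧ IsVec (b * conj d)) ∧
      (∀ v : V, IsReal (a * vec Q v * conj b - b * vec Q v * conj a) ∧
        IsReal (c * vec Q v * conj d - d * vec Q v * conj c)) ∧
      (∀ v : V, IsVec (a * vec Q v * conj d - b * vec Q v * conj c)) ∧
      (a * rev b = b * rev a ∧ c * rev d = d * rev c) ∧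
      (IsReal (pseudoDet !![a, b; c, d]) ∧ pseudoDet !![a, b; c, d] ≠ 0) := by
  obtain ⟨x, hx⟩ : ∃ x, toMat Q x = !![a, b; c, d] := ⟨_, toMat_ofMat Q _⟩
  have hsymm : (matEquiv Q).symm !![a, b; c, d] = x :=
    (matEquiv Q).injective (((matEquiv Q).apply_symm_apply _).trans hx.symm)
  have hnorm : (∃ r : ℝ, r ≠ 0 ∧ x * conj x = algebraMap ℝ (Cl (hatQ Q)) r) ↔
      (a * rev b = b * rev a ∧ c * rev d = d * rev c) ∧
      (IsReal (pseudoDet !![a, b; c, d]) ∧ pseudoDet !![a, b; c, d] ≠ 0) := by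
    have hmul : toMat Q (x * conj x) = !![a * rev d - b * rev c, b * rev a - a * rev b;
        c * rev d - d * rev c, d * rev a - c * rev b] := by
      rw [map_mul, toMat_conj, hx]
      ext i j
      fin_cases i <;> fin_cases j <;> simp [Matrix.mul_apply, Fin.sum_univ_two] <;> abel
    have hdet : pseudoDet !![a, b; c, d] = a * rev d - b * rev c := rfl
    have heq : ∀ r : ℝ, x * conj x = algebraMap ℝ (Cl (hatQ Q)) r ↔
        (a * rev b = b * rev a ∧ c * rev d = d * rev c) ∧
          pseudoDet !![a, b; c, d] = algebraMap ℝ (Cl Q) r := by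
      intro r
      have hinj : x * conj x = algebraMap ℝ (Cl (hatQ Q)) r ↔
          toMat Q (x * conj x) = algebraMap ℝ _ r := by
        rw [← (toMat Q).commutes r]
        exact (matEquiv Q).injective.eq_iff.symm
      rw [hinj, hmul, hdet]
      constructor
      · intro h
        have h00 := congrFun (congrFun h 0) 0
        have h01 := congrFun (congrFun h 0) 1
        have h10 := congrFun (congrFun h 1) 0
        simp [Matrix.algebraMap_matrix_apply] at h00 h01 h10
        exact ⟨⟨(sub_eq_zero.mp h01).symm, sub_eq_zero.mp h10⟩, h00⟩
      · rintro ⟨⟨h1, h2⟩, h3⟩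
        -- The lower right entry is the reversal of the pseudo-determinant, and reversal fixes
        -- reals.
        have h4 : d * rev a - c * rev b = algebraMap ℝ (Cl Q) r := by
          have h := congrArg rev h3
          simpa [CliffordAlgebra.reverse.map_mul] using h
        rw [h1, h2, h3, h4]
        ext i j
        fin_cases i <;> fin_cases j <;> simp [Matrix.algebraMap_matrix_apply]
    have hne : ∀ r : ℝ, algebraMap ℝ (Cl Q) r ≠ 0 ↔ r ≠ 0 := fun r =>
      (map_ne_zero_iff _ (algebraMap ℝ (Cl Q)).injective)
    constructor
    · rintro ⟨r, hr0, hr⟩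
      obtain ⟨h1, h2⟩ := (heq r).mp hr
      exact ⟨h1, ⟨r, h2⟩, by rwa [h2, hne]⟩
    · rintro ⟨h1, ⟨r, h2⟩, h3⟩
      rw [h2, hne] at h3
      exact ⟨r, h3, (heq r).mpr ⟨h1, h2⟩⟩
  have hvec : (∀ y, IsVec (x * vec (hatQ Q) y * rev x)) ↔
      (IsReal (a * conj a) ∧ IsReal (b * conj b) ∧ IsReal (c * conj c) ∧ IsReal (d * conj d)) ∧
      (IsVec (a * conj c) ∧ IsVec (b * conj d)) ∧
      (∀ v : V, IsReal (a * vec Q v * conj b - b * vec Q v * conj a) ∧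
        IsReal (c * vec Q v * conj d - d * vec Q v * conj c)) ∧
      (∀ v : V, IsVec (a * vec Q v * conj d - b * vec Q v * conj c)) := by
    have hs := toMat_sandwich _ hx
    constructor
    · intro h
      have hv := fun v => (isVec_iff_toMat _).mp (h (v, 0, 0))
      -- These null vectors have `(s + t, s - t)` equal to `(1, 0)` and `(0, 1)`, isolating the
      -- terms in `b, d` and in `a, c`.
      have hp := (isVec_iff_toMat _).mp (h (0, 2⁻¹, 2⁻¹))
      have hm := (isVec_iff_toMat _).mp (h (0, 2⁻¹, -2⁻¹))
      have h2 : (2⁻¹ : ℝ) + 2⁻¹ = 1 := by norm_num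
      simp [hs] at hv
      simp [hs, h2] at hp hm
      exact ⟨⟨hm.2.1, hp.2.1, hm.2.2.1, hp.2.2.1⟩, ⟨hm.1, hp.1⟩,
        fun v => ⟨(hv v).2.1, (hv v).2.2.1⟩, fun v => (hv v).1⟩
    · rintro ⟨⟨ha, hb, hc, hd⟩, ⟨hac, hbd⟩, h3, h4⟩ ⟨v, s, t⟩
      -- The lower right entry is the conjugate of the upper left one, hence its negative once that
      -- is a vector.
      have hconj : ∀ z : Cl Q, IsVec z → conj z = -z := by
        rintro _ ⟨w, rfl⟩
        exact conj_vec w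
      rw [isVec_iff_toMat, hs]
      refine ⟨((h4 v).add (hbd.smul _)).add (hac.smul _),
        ((h3 v).1.add (hb.smul _)).add (ha.smul _),
        ((h3 v).2.add (hd.smul _)).add (hc.smul _), ?_⟩
      have e1 := hconj _ (h4 v)
      have e2 := hconj _ hac
      have e3 := hconj _ hbd
      simp only [conj_sub, Vahlen.conj_mul, conj_conj, conj_vec] at e1 e2 e3
      simp only [Matrix.of_apply, Matrix.cons_val_zero, Matrix.cons_val_one, Matrix.cons_val',
        Matrix.cons_val_fin_one]
      rw [e2, e3, neg_add, neg_add, ← e1, smul_neg, smul_neg]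
      noncomm_ring
  rw [IsVahlen, hsymm, mem_lipschitzGroup_iff (nondegenerate_associated_neg_hatQ hQ), hnorm, hvec]
  tauto
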